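/- Let $\mathbb C_+=\{s\in\mathbb C:\operatorname{Re}s>0\}$, let $1<p\le 2$ and $\frac1p+\frac1{p'}=1$. Let $H^p(\mathbb C_+)$ be the space of analytic functions $\Phi$ on $\mathbb C_+$ with $\sup_{x>0}\big(\frac1{2\pi}\int_{-\infty}^\infty|\Phi(x+iy)|^p\,dy\big)^{1/p}<\infty$. For $\phi\in L^{p'}(\mathbb R_+)$ let $\mathcal L(\phi)(s)=\int_0^\infty e^{-st}\phi(t)\,dt$ for $s\in\mathbb C_+$, and for a function $\Phi$ on $\mathbb C_+$ let $\phi=\mathcal L^{-1}(\Phi)$ mean that $\phi$ is the unique element of $L^{p'}(\mathbb R_+)$ with $\mathcal L(\phi)=\Phi$ on $\mathbb C_+$. Let $f$ be analytic and not identically zero on a region containing $\mathbb C_+$, let $r$ be analytic on a region containing $\mathbb C_+$, and let $J\in L^{p'}(\mathbb R_+)$. A function $\phi\in L^{p'}(\mathbb R_+)$ is called a solution of $f(\partial_t)\phi=J$ (with $r$ fixed) if $f\mathcal L(\phi)-r\in H^p(\mathbb C_+)$ and $\mathcal L^{-1}(f\mathcal L(\phi)-r)=J$. Quotients by $f$ are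 understood as meromorphic functions, with removable singularities filled in. Assume that $\mathcal L(J)$, $\frac{\mathcal L(J)+r}{f}$ and $\frac{\mathcal L(J)}{f}$ belong to $H^p(\mathbb C_+)$. Assume also that $r/f$ is (the restriction to $\mathbb C_+$ of) an entire function $g$ for which there are $C\in\mathbb R$ and $q>0$ with $|g(s)|\le C/|s|^q$ for all $s\in\mathbb C$ with $|s|$ sufficiently large. Then the equation $f(\partial_t)\phi=J$ has exactly one solution $\phi\in L^{p'}(\mathbb R_+)$, and $$\phi=\mathcal L^{-1}\Big(\frac{\mathcal L(J)+r}{f}\Big)=\mathcal L^{-1}\Big(\frac{\mathcal L(J)}{f}\Big).$$ -/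

import Mathlib

open MeasureTheory
open scoped ENNReal NNReal

noncomputable section

/-- The open right half-plane `ℂ₊ = {s : 0 < Re s}`. -/
def rightHalfPlane : Set ℂ := {s : ℂ | 0 < s.re}

/-- The Lebesgue space `L^q(ℝ₊)` of complex-valued functions on the half-line. -/
abbrev LpHalfLine (q : ℝ) : Type :=
  Lp ℂ (ENNReal.ofReal q) (volume.restrict (Set.Ioi (0 : ℝ)))

/-- The Laplace transform `ℒ(g)(s) = ∫₀^∞ e^{-st} g(t) dt`. -/
def laplace (g : ℝ → ℂ) (s : ℂ) : ℂ :=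
  ∫ t in Set.Ioi (0 : ℝ), Complex.exp (-s * (t : ℂ)) * g t

/-- `μ_q(Φ, x) = ((1 / 2π) ∫ |Φ(x + iy)|^q dy)^{1/q}`, as an extended nonnegative number. -/
def hardyMean (q : ℝ) (Φ : ℂ → ℂ) (x : ℝ) : ℝ≥0∞ :=
  (ENNReal.ofReal (1 / (2 * Real.pi)) *
    ∫⁻ y : ℝ, ‖Φ ((x : ℂ) + (y : ℂ) * Complex.I)‖ₑ ^ q) ^ (1 / q)

/-- Membership in the Hardy space `H^q(ℂ₊)`. Only the values of `Φ` on `ℂ₊` matter. -/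
def MemHardy (q : ℝ) (Φ : ℂ → ℂ) : Prop :=
  DifferentiableOn ℂ Φ rightHalfPlane ∧
    ∃ C : ℝ≥0, ∀ x : ℝ, 0 < x → hardyMean q Φ x ≤ (C : ℝ≥0∞)

/-- `Φ` is the quotient `N / f` on `ℂ₊`. No condition is imposed at the zeros of `f`: for `Φ`
analytic on `ℂ₊` and `f` analytic and not identically zero, `Φ` is `N / f` with its removable
singularities filled in. -/
def IsQuotient (N f Φ : ℂ → ℂ) : Prop :=
  ∀ s ∈ rightHalfPlane, f s ≠ 0 → Φ s = N s / f s

/-- `φ = ℒ⁻¹(Φ)` in `L^q(ℝ₊)`: `φ` is the one and only element of `L^q(ℝ₊)` whose Laplace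
transform is `Φ` on `ℂ₊`. -/
def IsInverseLaplace (q : ℝ) (Φ : ℂ → ℂ) (φ : LpHalfLine q) : Prop :=
  (∀ s ∈ rightHalfPlane, laplace φ s = Φ s) ∧
    ∀ ψ : LpHalfLine q, (∀ s ∈ rightHalfPlane, laplace ψ s = Φ s) → ψ = φ

/-- The function `f ℒ(φ) - r` attached to the pair `(φ, r)`. -/
def symbolHat (f r : ℂ → ℂ) (φ : ℝ → ℂ) (s : ℂ) : ℂ := f s * laplace φ s - r s

/-- The pair `(φ, r)` lies in the domain `D_f` of `f(∂ₜ)`. -/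
def InSymbolDomain (p p' : ℝ) (f r : ℂ → ℂ) (φ : LpHalfLine p') : Prop :=
  MemHardy p (symbolHat f r φ)

/-- `φ ∈ L^{p'}(ℝ₊)` is a solution of `f(∂ₜ) φ = J`, with `r` fixed: `(φ, r) ∈ D_f` and
`f(∂ₜ)(φ, r) = ℒ⁻¹(f ℒ(φ) - r) = J`. -/
def IsSolution (p p' : ℝ) (f r : ℂ → ℂ) (J φ : LpHalfLine p') : Prop :=
  InSymbolDomain p p' f r φ ∧ IsInverseLaplace p' (symbolHat f r φ) J

end

/-! The decay bound and Liouville's theorem force the entire function `g` to vanish, so `r` is zero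
on the half-plane: off the zeros of `f` directly, and at those isolated zeros by continuity. Hence
`Φ = Ψ` and the equation reads `f ℒ(φ) = ℒ(J)`, that is `ℒ(φ) = Ψ`. Existence then requires every
function in `H^p` to be the Laplace transform of some function in `L^{p'}`. Uniqueness is the
injectivity of `ℒ`.

The representation of `H^p` functions rests on the Hausdorff–Young inequality, obtained from
Plancherel and the trivial `L¹`–`L^∞` bound by real interpolation (`exists_eLpNorm_fourier_le`). A
Hardy function `F` need not be integrable on vertical lines, so it is multiplied by `cutoff k`. For
the product, the Bromwich integral does not depend on the line (`integral_line_eq_of_lintegral_le`)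
and defines a function supported on `t ≥ 0` with the right Laplace transform
(`exists_laplace_eq_of_lintegral_line_le`). Hausdorff–Young bounds these functions in `L^{p'}`
uniformly in `k`, and a limit in `k` represents `F` itself
(`exists_memLp_laplace_eq_of_measurable`). -/

/-! ### Plancherel and Hausdorff–Young -/

open FourierTransform SchwartzMap in
theorem integral_fourier_smul_schwartz {h : ℝ → ℂ} (hh : Integrable h) (g : 𝓢(ℝ, ℂ)) :
    ∫ x, g x • 𝓕 h x = ∫ x, 𝓕 (g : ℝ → ℂ) x • h x := by
  have := VectorFourier.integral_fourierIntegral_smul_eq_flip (L := innerₗ ℝ) (μ := volume)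
    (ν := volume) Real.continuous_fourierChar continuous_inner g.integrable hh
  simp only [flip_innerₗ] at this
  exact this.symm

-- Both transforms satisfy the same duality with Schwartz functions, and locally integrable
-- functions are determined a.e. by their integrals against smooth compactly supported ones.
open FourierTransform SchwartzMap in
theorem fourier_ae_eq_fourier_toLp {h : ℝ → ℂ} (hh : Integrable h) (h2 : MemLp h 2) :
    𝓕 h =ᵐ[volume] (𝓕 (h2.toLp h) : Lp ℂ 2 (volume : Measure ℝ)) := by
  have hc : Continuous (𝓕 h) :=
    VectorFourier.fourierIntegral_continuous Real.continuous_fourierChar continuous_inner hh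
  apply ae_eq_of_integral_contDiff_smul_eq hc.locallyIntegrable
    ((Lp.memLp _).locallyIntegrable one_le_two)
  intro g hg hgc
  have hg₁ : HasCompactSupport (Complex.ofRealCLM ∘ g) := hgc.comp_left rfl
  have hg₂ : ContDiff ℝ ((⊤ : ℕ∞) : WithTop ℕ∞) (Complex.ofRealCLM ∘ g) := Complex.ofRealCLM.contDiff.comp hg
  set G : 𝓢(ℝ, ℂ) := hg₁.toSchwartzMap hg₂
  have e1 := integral_fourier_smul_schwartz hh G
  have e2 := congrArg (fun T => T G) (Lp.fourier_toTemperedDistribution_eq (h2.toLp h))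
  simp only [TemperedDistribution.fourier_apply, Lp.toTemperedDistribution_apply] at e2
  have e3 : ∫ x, (𝓕 G : 𝓢(ℝ, ℂ)) x • (h2.toLp h) x = ∫ x, 𝓕 (G : ℝ → ℂ) x • h x := by
    apply integral_congr_ae
    filter_upwards [h2.coeFn_toLp] with x hx
    rw [hx, SchwartzMap.fourier_coe]
  have e4 : ∀ u : ℝ → ℂ, ∫ x, g x • u x = ∫ x, G x • u x := by
    intro u
    simp [G]
  rw [e4, e4, e1, ← e3, e2]

open FourierTransform in
/-- Plancherel's inequality for integrable functions. -/
theorem lintegral_enorm_fourier_sq_le {h : ℝ → ℂ} (hh : Integrable h) :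
    ∫⁻ x, ‖𝓕 h x‖ₑ ^ (2 : ℝ) ≤ ∫⁻ x, ‖h x‖ₑ ^ (2 : ℝ) := by
  by_cases h2 : MemLp h 2
  · have key : eLpNorm (𝓕 h) 2 volume = eLpNorm h 2 volume := by
      rw [eLpNorm_congr_ae (fourier_ae_eq_fourier_toLp hh h2),
        eLpNorm_congr_ae h2.coeFn_toLp.symm, ← Lp.enorm_def, ← Lp.enorm_def]
      rw [← ofReal_norm, ← ofReal_norm, Lp.norm_fourier_eq]
    rw [eLpNorm_eq_lintegral_rpow_enorm_toReal two_ne_zero ENNReal.ofNat_ne_top,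
      eLpNorm_eq_lintegral_rpow_enorm_toReal two_ne_zero ENNReal.ofNat_ne_top] at key
    simp only [ENNReal.toReal_ofNat] at key
    exact (ENNReal.rpow_left_injective (by norm_num) key).le
  · have : ∫⁻ x, ‖h x‖ₑ ^ (2 : ℝ) = ∞ := by
      by_contra hne
      apply h2
      refine ⟨hh.1, ?_⟩
      rw [eLpNorm_lt_top_iff_lintegral_rpow_enorm_lt_top two_ne_zero ENNReal.ofNat_ne_top]
      simpa using Ne.lt_top hne
    rw [this]; exact le_top

open FourierTransform in
theorem enorm_fourier_le_lintegral (h : ℝ → ℂ) (x : ℝ) : ‖𝓕 h x‖ₑ ≤ ∫⁻ y, ‖h y‖ₑ := by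
  rw [Real.fourier_eq]
  refine (enorm_integral_le_lintegral_enorm _).trans (le_of_eq ?_)
  congr with y
  rw [← ofReal_norm, ← ofReal_norm, Circle.norm_smul]

open FourierTransform in
theorem fourier_add_apply {f g : ℝ → ℂ} (hf : Integrable f) (hg : Integrable g) (x : ℝ) :
    𝓕 (f + g) x = 𝓕 f x + 𝓕 g x :=
  congrFun (VectorFourier.fourierIntegral_add (L := innerₗ ℝ) Real.continuous_fourierChar
    continuous_inner hf hg) x

theorem sub_one_mul_sub_one_of_holderConjugate {p p' : ℝ} (hpp : p.HolderConjugate p') :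
    (p - 1) * (p' - 1) = 1 := by
  linarith [hpp.mul_eq_add]

theorem lintegral_Ioc_rpow {b r : ℝ} (hb : 0 ≤ b) (hr : 0 < r) :
    ∫⁻ l in Set.Ioc 0 b, ENNReal.ofReal (l ^ (r - 1)) = ENNReal.ofReal (b ^ r / r) := by
  have hi : IntervalIntegrable (fun l : ℝ => l ^ (r - 1)) volume 0 b :=
    intervalIntegral.intervalIntegrable_rpow' (by linarith)
  rw [← ofReal_integral_eq_lintegral_ofReal, ← intervalIntegral.integral_of_le hb,
    integral_rpow (Or.inl (by linarith))]
  · simp [Real.zero_rpow hr.ne']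
  · rwa [intervalIntegrable_iff_integrableOn_Ioc_of_le hb] at hi
  · filter_upwards [ae_restrict_mem measurableSet_Ioc] with l hl
    exact Real.rpow_nonneg hl.1.le _

/-- For `c > 0` the condition cuts the integral off at `b = 2a / c^(p-1)`, which leaves `c² b^(p'-2)
/ (p'-2)`. Since `(p-1)(p'-2) = 2-p`, the power of `c` is exactly `p`. This is the inner integral
after Tonelli in the interpolation argument. -/
theorem lintegral_truncated_sq_le {p p' a c : ℝ} (hp1 : 1 < p) (hp2 : p < 2)
    (hpp : p.HolderConjugate p') (ha : 0 < a) (hc : 0 ≤ c) :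
    ∫⁻ l in Set.Ioi (0 : ℝ), ENNReal.ofReal (l ^ (p' - 2 - 1)) *
      (if l * c ^ (p - 1) ≤ 2 * a then ENNReal.ofReal (c ^ 2) else 0) ≤
    ENNReal.ofReal ((2 * a) ^ (p' - 2) / (p' - 2)) * ENNReal.ofReal (c ^ p) := by
  have hmul : (p - 1) * (p' - 1) = 1 := sub_one_mul_sub_one_of_holderConjugate hpp
  have hp' : 2 < p' := by nlinarith [hpp.symm.lt]
  rcases hc.eq_or_lt with rfl | hc
  · simp
  have hcp : 0 < c ^ (p - 1) := by positivity
  set b := 2 * a / c ^ (p - 1) with hb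
  have hb0 : 0 < b := by positivity
  have e : ∀ l ∈ Set.Ioi (0 : ℝ), ENNReal.ofReal (l ^ (p' - 2 - 1)) *
      (if l * c ^ (p - 1) ≤ 2 * a then ENNReal.ofReal (c ^ 2) else 0) =
      (Set.Ioc 0 b).indicator (fun l => ENNReal.ofReal (l ^ (p' - 2 - 1)) *
        ENNReal.ofReal (c ^ 2)) l := by
    intro l hl
    have : l * c ^ (p - 1) ≤ 2 * a ↔ l ∈ Set.Ioc 0 b := by
      rw [hb, Set.mem_Ioc, le_div_iff₀ hcp]
      exact ⟨fun h => ⟨hl, h⟩, fun h => h.2⟩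
    by_cases h : l ∈ Set.Ioc 0 b
    · rw [if_pos (this.2 h), Set.indicator_of_mem h]
    · rw [if_neg (mt this.1 h), Set.indicator_of_notMem h, mul_zero]
  rw [setLIntegral_congr_fun measurableSet_Ioi e, lintegral_indicator measurableSet_Ioc,
    Measure.restrict_restrict measurableSet_Ioc,
    Set.inter_eq_left.2 Set.Ioc_subset_Ioi_self, lintegral_mul_const _ (by fun_prop),
    lintegral_Ioc_rpow hb0.le (by linarith), ← ENNReal.ofReal_mul, ← ENNReal.ofReal_mul]
  · apply ENNReal.ofReal_le_ofReal
    apply le_of_eq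
    have h1 : (p - 1) * (p' - 2) = 2 - p := by linarith
    have h2 : c ^ 2 = c ^ p * c ^ (2 - p) := by
      rw [← Real.rpow_add hc, ← Real.rpow_natCast]; norm_num
    rw [hb, Real.div_rpow (by positivity) (by positivity), ← Real.rpow_mul hc.le, h1, h2]
    have : c ^ (2 - p) ≠ 0 := by positivity
    field_simp
  · have : 0 < p' - 2 := by linarith
    positivity
  · have : 0 < p' - 2 := by linarith
    positivity

-- The function is split at a height depending on the level `l`. Where `l ‖h‖^(p-1) > 2a`, one has
-- `‖h‖ ≤ (l / 2a) ‖h‖^p`, so that part has `L¹` norm at most `l/2` and its transform never exceeds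
-- `l/2`. The transform of the remaining part must then be at least `l/2` on the level set, and
-- Chebyshev with Plancherel bounds the measure.
open FourierTransform in
theorem volume_lt_norm_fourier_mul_le {h : ℝ → ℂ} (hm : Measurable h) (hh : Integrable h)
    {p a l : ℝ} (ha : 0 < a) (hl : 0 < l)
    (hA : ∫⁻ x, ‖h x‖ₑ ^ p = ENNReal.ofReal a) :
    volume {x | l < ‖𝓕 h x‖} ≤ ENNReal.ofReal (4 / l ^ 2) *
      ∫⁻ x, (if l * ‖h x‖ ^ (p - 1) ≤ 2 * a then ENNReal.ofReal (‖h x‖ ^ 2) else 0) := by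
  set S : Set ℝ := {x | l * ‖h x‖ ^ (p - 1) ≤ 2 * a} with hS
  have hSm : MeasurableSet S := measurableSet_le (by fun_prop) measurable_const
  have hdec : h = S.indicator h + Sᶜ.indicator h := (Set.indicator_self_add_compl S h).symm
  have hlarge : ∫⁻ y, ‖Sᶜ.indicator h y‖ₑ ≤ ENNReal.ofReal (l / 2) := by
    calc ∫⁻ y, ‖Sᶜ.indicator h y‖ₑ ≤ ∫⁻ y, ENNReal.ofReal (l / (2 * a)) * ‖h y‖ₑ ^ p := by
          apply lintegral_mono
          intro y
          by_cases hy : y ∈ S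
          · simp [hy]
          have hy' : y ∈ Sᶜ := hy
          simp only [Set.indicator_of_mem hy']
          simp only [hS, Set.mem_ofPred_eq, not_le] at hy
          rcases eq_or_ne (h y) 0 with h0 | h0
          · simp [h0]
          have hn : 0 < ‖h y‖ := norm_pos_iff.2 h0
          rw [← ofReal_norm, ENNReal.ofReal_rpow_of_pos hn, ← ENNReal.ofReal_mul (by positivity)]
          apply ENNReal.ofReal_le_ofReal
          have : ‖h y‖ ^ p = ‖h y‖ ^ (p - 1) * ‖h y‖ := by
            rw [← Real.rpow_add_one hn.ne']; ring_nf
          rw [this, div_mul_eq_mul_div, le_div_iff₀ (by positivity)]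
          nlinarith
      _ = ENNReal.ofReal (l / 2) := by
          rw [lintegral_const_mul _ (by fun_prop), hA, ← ENNReal.ofReal_mul (by positivity)]
          congr 1
          field_simp
  have hsub : {x | l < ‖𝓕 h x‖} ⊆
      {x | ENNReal.ofReal ((l / 2) ^ 2) ≤ ‖𝓕 (S.indicator h) x‖ₑ ^ (2 : ℝ)} := by
    intro x hx
    simp only [Set.mem_ofPred_eq] at hx ⊢
    have h1 : 𝓕 h x = 𝓕 (S.indicator h) x + 𝓕 (Sᶜ.indicator h) x := by
      conv_lhs => rw [hdec]
      exact fourier_add_apply (hh.indicator hSm) (hh.indicator hSm.compl) x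
    have h2 : ‖𝓕 (Sᶜ.indicator h) x‖ ≤ l / 2 := by
      have := (enorm_fourier_le_lintegral (Sᶜ.indicator h) x).trans hlarge
      rwa [← ofReal_norm, ENNReal.ofReal_le_ofReal_iff (by positivity)] at this
    have h3 : l / 2 ≤ ‖𝓕 (S.indicator h) x‖ := by
      rw [h1] at hx
      linarith [norm_add_le (𝓕 (S.indicator h) x) (𝓕 (Sᶜ.indicator h) x)]
    rw [← ofReal_norm, ENNReal.ofReal_rpow_of_nonneg (norm_nonneg _) (by norm_num)]
    apply ENNReal.ofReal_le_ofReal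
    rw [Real.rpow_two]
    gcongr
  have hc : Continuous (𝓕 (S.indicator h)) :=
    VectorFourier.fourierIntegral_continuous Real.continuous_fourierChar continuous_inner
      (hh.indicator hSm)
  have hmark := (mul_meas_ge_le_lintegral (μ := volume)
    (f := fun x => ‖𝓕 (S.indicator h) x‖ₑ ^ (2 : ℝ)) (by fun_prop)
    (ENNReal.ofReal ((l / 2) ^ 2))).trans (lintegral_enorm_fourier_sq_le (hh.indicator hSm))
  have hsq : ∫⁻ x, ‖S.indicator h x‖ₑ ^ (2 : ℝ) =
      ∫⁻ x, (if l * ‖h x‖ ^ (p - 1) ≤ 2 * a then ENNReal.ofReal (‖h x‖ ^ 2) else 0) := by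
    congr with x
    by_cases hx : x ∈ S
    · rw [Set.indicator_of_mem hx, if_pos (show l * ‖h x‖ ^ (p - 1) ≤ 2 * a from hx), ← ofReal_norm,
        ENNReal.ofReal_rpow_of_nonneg (norm_nonneg _) (by norm_num), Real.rpow_two]
    · rw [Set.indicator_of_notMem hx, if_neg (show ¬ l * ‖h x‖ ^ (p - 1) ≤ 2 * a from hx)]
      simp
  rw [hsq] at hmark
  calc volume {x | l < ‖𝓕 h x‖} ≤ _ := measure_mono hsub
    _ = ENNReal.ofReal (4 / l ^ 2) * (ENNReal.ofReal ((l / 2) ^ 2) * volume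
      {x | ENNReal.ofReal ((l / 2) ^ 2) ≤ ‖𝓕 (S.indicator h) x‖ₑ ^ (2 : ℝ)}) := by
        rw [← mul_assoc, ← ENNReal.ofReal_mul (by positivity)]
        have : 4 / l ^ 2 * (l / 2) ^ 2 = 1 := by field_simp; norm_num
        rw [this]; simp
    _ ≤ _ := by gcongr

-- Marcinkiewicz interpolation: the layer-cake formula turns the left side into an integral of
-- level-set measures, and Tonelli lets the integral over levels be done first at each point.
open FourierTransform in
theorem lintegral_enorm_fourier_rpow_le {h : ℝ → ℂ} (hm : Measurable h) (hh : Integrable h)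
    {p p' a : ℝ} (hp1 : 1 < p) (hp2 : p < 2) (hpp : p.HolderConjugate p') (ha : 0 < a)
    (hA : ∫⁻ x, ‖h x‖ₑ ^ p = ENNReal.ofReal a) :
    ∫⁻ x, ‖𝓕 h x‖ₑ ^ p' ≤
      ENNReal.ofReal (p' * 4 * 2 ^ (p' - 2) / (p' - 2)) * ENNReal.ofReal a ^ (p' - 1) := by
  have hmul : (p - 1) * (p' - 1) = 1 := sub_one_mul_sub_one_of_holderConjugate hpp
  have hp' : 2 < p' := by nlinarith [hpp.symm.lt]
  have hp'' : 0 < p' - 2 := by linarith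
  have hp0 : 0 < p' := by linarith
  have hc : Continuous (𝓕 h) :=
    VectorFourier.fourierIntegral_continuous Real.continuous_fourierChar continuous_inner hh
  have hcake := lintegral_rpow_eq_lintegral_meas_lt_mul volume (f := fun x => ‖𝓕 h x‖)
    (Filter.Eventually.of_forall fun x => norm_nonneg _) hc.norm.aemeasurable hp0
  have e1 : ∀ x, ‖𝓕 h x‖ₑ ^ p' = ENNReal.ofReal (‖𝓕 h x‖ ^ p') := fun x => by
    rw [← ofReal_norm, ENNReal.ofReal_rpow_of_nonneg (norm_nonneg _) hp0.le]
  simp_rw [e1]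
  rw [hcake]
  calc _ ≤ ENNReal.ofReal p' * ∫⁻ l in Set.Ioi (0 : ℝ), ENNReal.ofReal 4 * ∫⁻ x,
          ENNReal.ofReal (l ^ (p' - 2 - 1)) *
          (if l * ‖h x‖ ^ (p - 1) ≤ 2 * a then ENNReal.ofReal (‖h x‖ ^ 2) else 0) := by
        refine mul_le_mul_right ?_ _
        apply setLIntegral_mono' measurableSet_Ioi
        intro l hl
        have hl : 0 < l := hl
        rw [lintegral_const_mul' _ _ ENNReal.ofReal_ne_top]
        refine (mul_le_mul_left (volume_lt_norm_fourier_mul_le hm hh ha hl hA) _).trans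
          (le_of_eq ?_)
        rw [mul_right_comm, ← mul_assoc, ← ENNReal.ofReal_mul (by positivity),
          ← ENNReal.ofReal_mul (by positivity)]
        congr 2
        have : l ^ (p' - 1) = l ^ (p' - 2 - 1) * l ^ 2 := by
          rw [← Real.rpow_natCast, ← Real.rpow_add hl]; norm_num; ring_nf
        rw [this]; field_simp
    _ = ENNReal.ofReal p' * (ENNReal.ofReal 4 * ∫⁻ x, ∫⁻ l in Set.Ioi (0 : ℝ),
          ENNReal.ofReal (l ^ (p' - 2 - 1)) *
          (if l * ‖h x‖ ^ (p - 1) ≤ 2 * a then ENNReal.ofReal (‖h x‖ ^ 2) else 0)) := by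
        rw [lintegral_const_mul' _ _ ENNReal.ofReal_ne_top, lintegral_lintegral_swap]
        apply Measurable.aemeasurable
        apply Measurable.mul
        · fun_prop
        · refine Measurable.ite (measurableSet_le ?_ measurable_const) ?_ measurable_const
          · exact measurable_fst.mul ((hm.comp measurable_snd).norm.pow_const _)
          · exact ((hm.comp measurable_snd).norm.pow_const _).ennreal_ofReal
    _ ≤ ENNReal.ofReal p' * (ENNReal.ofReal 4 * ∫⁻ x,
          ENNReal.ofReal ((2 * a) ^ (p' - 2) / (p' - 2)) * ‖h x‖ₑ ^ p) := by
        gcongr with x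
        rw [← ofReal_norm, ENNReal.ofReal_rpow_of_nonneg (norm_nonneg _) (by linarith)]
        exact lintegral_truncated_sq_le hp1 hp2 hpp ha (norm_nonneg _)
    _ = _ := by
        rw [lintegral_const_mul' _ _ ENNReal.ofReal_ne_top, hA, ENNReal.ofReal_rpow_of_pos ha,
          ← ENNReal.ofReal_mul (by positivity), ← ENNReal.ofReal_mul (by positivity),
          ← ENNReal.ofReal_mul (by positivity), ← ENNReal.ofReal_mul (by positivity)]
        congr 1
        have : a ^ (p' - 1) = a ^ (p' - 2) * a := by
          rw [← Real.rpow_add_one ha.ne']; ring_nf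
        rw [this, Real.mul_rpow (by norm_num) ha.le]
        ring

open FourierTransform in
/-- The Hausdorff–Young inequality, with some constant depending on the exponent. -/
theorem exists_eLpNorm_fourier_le {p p' : ℝ} (hp1 : 1 < p) (hp2 : p ≤ 2)
    (hpp : p.HolderConjugate p') : ∃ K : ℝ≥0, ∀ h : ℝ → ℂ, Integrable h →
      eLpNorm (𝓕 h) (ENNReal.ofReal p') volume ≤ K * eLpNorm h (ENNReal.ofReal p) volume := by
  have hp0 : 0 < p := by linarith
  have hp'0 : 0 < p' := hpp.symm.pos
  rcases hp2.eq_or_lt with rfl | hp2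
  · refine ⟨1, fun h hh => ?_⟩
    obtain rfl : p' = 2 := by
      have := sub_one_mul_sub_one_of_holderConjugate hpp
      linarith
    rw [eLpNorm_eq_lintegral_rpow_enorm_toReal (by simp) (by simp),
      eLpNorm_eq_lintegral_rpow_enorm_toReal (by simp) (by simp), ENNReal.toReal_ofReal (by simp)]
    rw [ENNReal.coe_one, one_mul]
    exact ENNReal.rpow_le_rpow (lintegral_enorm_fourier_sq_le hh) (by positivity)
  have hmul : (p - 1) * (p' - 1) = 1 := sub_one_mul_sub_one_of_holderConjugate hpp
  have hp' : 2 < p' := by nlinarith [hpp.symm.lt]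
  set K := p' * 4 * 2 ^ (p' - 2) / (p' - 2)
  have hK : 0 < K := by
    have : 0 < p' - 2 := by linarith
    positivity
  refine ⟨(K ^ (1 / p')).toNNReal, fun h hh => ?_⟩
  change _ ≤ ENNReal.ofReal _ * _
  wlog hm : Measurable h generalizing h
  · have h1 := hh.1.ae_eq_mk
    have := this (hh.1.mk h) (hh.congr h1) hh.1.stronglyMeasurable_mk.measurable
    rwa [← eLpNorm_congr_ae h1, ← funext (Real.fourier_congr_ae h1)] at this
  -- The splitting height needs `0 < a < ∞`, so the two degenerate norms are treated apart.
  by_cases h0 : eLpNorm h (ENNReal.ofReal p) volume = 0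
  · rw [eLpNorm_eq_zero_iff hh.1 (by simpa using hp0)] at h0
    have : 𝓕 h = 0 := by
      funext x
      rw [Real.fourier_congr_ae h0 x, Real.fourier_eq]
      simp
    simp [this]
  by_cases htop : eLpNorm h (ENNReal.ofReal p) volume = ∞
  · rw [htop, ENNReal.mul_top (by simp; positivity)]
    exact le_top
  rw [eLpNorm_eq_lintegral_rpow_enorm_toReal (p := ENNReal.ofReal p) (by simpa using hp0) (by simp),
    ENNReal.toReal_ofReal hp0.le] at h0 htop ⊢
  rw [eLpNorm_eq_lintegral_rpow_enorm_toReal (by simpa using hp'0) (by simp),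
    ENNReal.toReal_ofReal hp'0.le]
  set A := ∫⁻ x, ‖h x‖ₑ ^ p with hA
  have hA0 : A ≠ 0 := fun h => h0 (by rw [h, ENNReal.zero_rpow_of_pos (by positivity)])
  have hAt : A ≠ ∞ := fun h => htop (by rw [h, ENNReal.top_rpow_of_pos (by positivity)])
  have key := lintegral_enorm_fourier_rpow_le hm hh hp1 hp2 hpp (ENNReal.toReal_pos hA0 hAt)
    (hA.symm.trans (ENNReal.ofReal_toReal hAt).symm)
  rw [ENNReal.ofReal_toReal hAt] at key
  refine (ENNReal.rpow_le_rpow key (by positivity)).trans (le_of_eq ?_)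
  rw [ENNReal.mul_rpow_of_nonneg _ _ (by positivity), ENNReal.ofReal_rpow_of_pos hK,
    ← ENNReal.rpow_mul]
  congr 2
  have := hpp.inv_add_inv_eq_one
  rw [sub_mul, mul_one_div_cancel hp'0.ne']
  simp only [one_div]; linarith

/-! ### The inverse Fourier transform from `L^p` to `L^{p'}` -/

open FourierTransform in
theorem fourierInv_sub {f g : ℝ → ℂ} (hf : Integrable f) (hg : Integrable g) :
    𝓕⁻ (f - g) = 𝓕⁻ f - 𝓕⁻ g := by
  funext x
  have := fourier_add_apply (hf.sub hg) hg (-x)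
  rw [sub_add_cancel] at this
  rw [Pi.sub_apply, Real.fourierInv_eq_fourier_neg, Real.fourierInv_eq_fourier_neg,
    Real.fourierInv_eq_fourier_neg, this, add_sub_cancel_right]

open FourierTransform in
theorem continuous_fourierInv {h : ℝ → ℂ} (hh : Integrable h) : Continuous (𝓕⁻ h) := by
  have hc : Continuous (𝓕 h) :=
    VectorFourier.fourierIntegral_continuous Real.continuous_fourierChar continuous_inner hh
  rw [show 𝓕⁻ h = fun x => 𝓕 h (-x) from funext fun x => Real.fourierInv_eq_fourier_neg h x]
  fun_prop

open FourierTransform in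
theorem exists_eLpNorm_fourierInv_le {p p' : ℝ} (hp1 : 1 < p) (hp2 : p ≤ 2)
    (hpp : p.HolderConjugate p') : ∃ K : ℝ≥0, ∀ h : ℝ → ℂ, Integrable h →
      eLpNorm (𝓕⁻ h) (ENNReal.ofReal p') volume ≤ K * eLpNorm h (ENNReal.ofReal p) volume := by
  obtain ⟨K, hK⟩ := exists_eLpNorm_fourier_le hp1 hp2 hpp
  refine ⟨K, fun h hh => ?_⟩
  refine le_of_eq_of_le ?_ (hK h hh)
  have hc : Continuous (𝓕 h) :=
    VectorFourier.fourierIntegral_continuous Real.continuous_fourierChar continuous_inner hh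
  rw [show 𝓕⁻ h = 𝓕 h ∘ Neg.neg from funext fun x => Real.fourierInv_eq_fourier_neg h x]
  exact eLpNorm_comp_measurePreserving hc.aestronglyMeasurable
    (Measure.measurePreserving_neg volume)

open FourierTransform Filter Topology in
/-- The inverse Fourier transform extends continuously from `L^p` to `L^{p'}`. -/
theorem exists_tendsto_eLpNorm_fourierInv {p p' : ℝ} (hp1 : 1 < p) (hp2 : p ≤ 2)
    (hpp : p.HolderConjugate p') {h : ℕ → ℝ → ℂ} {H : ℝ → ℂ} (hi : ∀ n, Integrable (h n))
    (hm : ∀ n, MemLp (h n) (ENNReal.ofReal p)) (hH : MemLp H (ENNReal.ofReal p))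
    (hlim : Tendsto (fun n => eLpNorm (h n - H) (ENNReal.ofReal p) volume) atTop (𝓝 0)) :
    ∃ u : ℝ → ℂ, MemLp u (ENNReal.ofReal p') ∧
      Tendsto (fun n => eLpNorm (𝓕⁻ (h n) - u) (ENNReal.ofReal p') volume) atTop (𝓝 0) := by
  obtain ⟨K, hK⟩ := exists_eLpNorm_fourierInv_le hp1 hp2 hpp
  have : Fact (1 ≤ ENNReal.ofReal p') := ⟨by simpa using hpp.symm.lt.le⟩
  have hp : 1 ≤ ENNReal.ofReal p := by simpa using hp1.le
  have hF : ∀ n, MemLp (𝓕⁻ (h n)) (ENNReal.ofReal p') := fun n =>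
    ⟨(continuous_fourierInv (hi n)).aestronglyMeasurable,
      (hK _ (hi n)).trans_lt (ENNReal.mul_lt_top ENNReal.coe_lt_top (hm n).2)⟩
  have hcau : CauchySeq fun n => (hF n).toLp := by
    rw [Lp.cauchySeq_Lp_iff_cauchySeq_eLpNorm]
    have hle : ∀ n : ℕ × ℕ, eLpNorm (⇑(hF n.1).toLp - ⇑(hF n.2).toLp) (ENNReal.ofReal p') volume ≤
        K * (eLpNorm (h n.1 - H) (ENNReal.ofReal p) volume +
          eLpNorm (h n.2 - H) (ENNReal.ofReal p) volume) := by
      intro n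
      rw [eLpNorm_congr_ae ((hF n.1).coeFn_toLp.sub (hF n.2).coeFn_toLp),
        ← fourierInv_sub (hi _) (hi _)]
      refine (hK _ ((hi _).sub (hi _))).trans ?_
      gcongr
      rw [show h n.1 - h n.2 = (h n.1 - H) - (h n.2 - H) by abel]
      exact eLpNorm_sub_le ((hm _).1.sub hH.1) ((hm _).1.sub hH.1) hp
    refine tendsto_of_tendsto_of_tendsto_of_le_of_le tendsto_const_nhds ?_
      (fun n => zero_le) hle
    have h1 := (hlim.comp (tendsto_fst (f := atTop) (g := atTop))).add
      (hlim.comp (tendsto_snd (f := (atTop : Filter ℕ)) (g := atTop)))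
    rw [prod_atTop_atTop_eq] at h1
    simpa using ENNReal.Tendsto.const_mul h1 (Or.inr (ENNReal.coe_ne_top (r := K)))
  obtain ⟨u, hu⟩ := cauchySeq_tendsto_of_complete hcau
  refine ⟨u, Lp.memLp u, ?_⟩
  rw [Lp.tendsto_Lp_iff_tendsto_eLpNorm'] at hu
  refine hu.congr fun n => eLpNorm_congr_ae ?_
  filter_upwards [(hF n).coeFn_toLp] with x hx
  simp [hx]

/-! ### The Laplace transform on `L^{p'}(ℝ₊)`: analyticity and injectivity -/

theorem memLp_exp_neg_mul {s : ℂ} (hs : 0 < s.re) {p : ℝ} (hp : 0 < p) :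
    MemLp (fun t : ℝ => Complex.exp (-s * t)) (ENNReal.ofReal p)
      (volume.restrict (Set.Ioi (0 : ℝ))) := by
  have hc : Continuous fun t : ℝ => Complex.exp (-s * t) := by fun_prop
  rw [← integrable_norm_rpow_iff hc.aestronglyMeasurable (by simpa using hp) (by simp),
    ENNReal.toReal_ofReal hp.le]
  have := integrableOn_exp_mul_Ioi (show -(p * s.re) < 0 by nlinarith) 0
  refine this.congr (Filter.Eventually.of_forall fun t => ?_)
  simp only [Complex.norm_exp, ← Real.exp_mul]
  congr 1
  simp; ring

theorem enorm_laplace_le {p p' : ℝ} (hpp : p.HolderConjugate p') {φ : ℝ → ℂ}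
    (hφ : AEStronglyMeasurable φ (volume.restrict (Set.Ioi (0 : ℝ)))) (s : ℂ) :
    ‖laplace φ s‖ₑ ≤
      eLpNorm (fun t : ℝ => Complex.exp (-s * t)) (ENNReal.ofReal p)
        (volume.restrict (Set.Ioi (0 : ℝ))) *
      eLpNorm φ (ENNReal.ofReal p') (volume.restrict (Set.Ioi (0 : ℝ))) := by
  have := hpp.ennrealOfReal
  have hc : Continuous fun t : ℝ => Complex.exp (-s * t) := by fun_prop
  calc ‖laplace φ s‖ₑ ≤ ∫⁻ t in Set.Ioi (0 : ℝ), ‖Complex.exp (-s * t) * φ t‖ₑ :=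
        enorm_integral_le_lintegral_enorm _
    _ = eLpNorm ((fun t : ℝ => Complex.exp (-s * t)) • φ) 1
        (volume.restrict (Set.Ioi (0 : ℝ))) := by
        rw [eLpNorm_one_eq_lintegral_enorm]; rfl
    _ ≤ _ := eLpNorm_smul_le_mul_eLpNorm hφ hc.aestronglyMeasurable

theorem integrable_exp_neg_mul_mul {p p' : ℝ} (hpp : p.HolderConjugate p') {φ : ℝ → ℂ}
    (hφ : MemLp φ (ENNReal.ofReal p') (volume.restrict (Set.Ioi (0 : ℝ)))) {s : ℂ}
    (hs : 0 < s.re) :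
    IntegrableOn (fun t : ℝ => Complex.exp (-s * t) * φ t) (Set.Ioi 0) := by
  have := hpp.ennrealOfReal
  exact (memLp_exp_neg_mul hs hpp.pos).integrable_mul hφ

theorem laplace_sub {p p' : ℝ} (hpp : p.HolderConjugate p') {φ ψ : ℝ → ℂ}
    (hφ : MemLp φ (ENNReal.ofReal p') (volume.restrict (Set.Ioi (0 : ℝ))))
    (hψ : MemLp ψ (ENNReal.ofReal p') (volume.restrict (Set.Ioi (0 : ℝ)))) {s : ℂ}
    (hs : 0 < s.re) : laplace (φ - ψ) s = laplace φ s - laplace ψ s := by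
  simp only [laplace, Pi.sub_apply, mul_sub]
  exact integral_sub (integrable_exp_neg_mul_mul hpp hφ hs) (integrable_exp_neg_mul_mul hpp hψ hs)

theorem laplace_congr_ae {φ ψ : ℝ → ℂ} (h : φ =ᵐ[volume.restrict (Set.Ioi (0 : ℝ))] ψ) (s : ℂ) :
    laplace φ s = laplace ψ s := by
  apply integral_congr_ae
  filter_upwards [h] with t ht
  rw [ht]

theorem differentiableOn_laplace {p p' : ℝ} (hpp : p.HolderConjugate p') {φ : ℝ → ℂ}
    (hφ : MemLp φ (ENNReal.ofReal p') (volume.restrict (Set.Ioi (0 : ℝ)))) :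
    DifferentiableOn ℂ (laplace φ) rightHalfPlane := by
  intro s₀ hs₀
  have hs₀ : 0 < s₀.re := hs₀
  -- On the ball of radius `2a` the real part stays above `2a`. Half of the decay `e^(-2at)` absorbs
  -- the factor `t`, and the other half gives the dominating function.
  set a := s₀.re / 4 with ha
  have ha0 : 0 < a := by positivity
  have hb := (integrable_exp_neg_mul_mul hpp hφ (s := (a : ℂ)) (by simpa using ha0)).norm.const_mul
    (1 / a)
  refine (hasDerivAt_integral_of_dominated_loc_of_deriv_le (𝕜 := ℂ)
    (F := fun (s : ℂ) (t : ℝ) => Complex.exp (-s * t) * φ t)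
    (F' := fun (s : ℂ) (t : ℝ) => (-(t : ℂ)) * Complex.exp (-s * t) * φ t)
    (Metric.ball_mem_nhds s₀ (show 0 < 2 * a by positivity)) ?_
    (integrable_exp_neg_mul_mul hpp hφ hs₀) ?_ ?_ hb ?_).2.differentiableAt.differentiableWithinAt
  · refine Filter.Eventually.of_forall fun s => ?_
    exact (Continuous.aestronglyMeasurable (by fun_prop)).mul hφ.1
  · exact (Continuous.aestronglyMeasurable (by fun_prop)).mul hφ.1
  · filter_upwards [ae_restrict_mem measurableSet_Ioi] with t ht s hs
    have ht : 0 < t := ht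
    have hre : 2 * a ≤ s.re := by
      have h1 := Complex.abs_re_le_norm (s - s₀)
      rw [Metric.mem_ball, dist_eq_norm] at hs
      have := (abs_le.1 h1).1
      rw [Complex.sub_re] at this
      linarith
    rw [norm_mul, norm_mul, norm_mul, norm_neg, ← mul_assoc, Complex.norm_exp, Complex.norm_exp]
    refine mul_le_mul_of_nonneg_right ?_ (norm_nonneg _)
    have e1 : (-s * (t : ℂ)).re = -(s.re * t) := by simp
    have e2 : (-(a : ℂ) * (t : ℂ)).re = -(a * t) := by simp
    rw [e1, e2, Complex.norm_real, Real.norm_of_nonneg ht.le]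
    have h2 : t ≤ 1 / a * Real.exp (a * t) := by
      rw [div_mul_eq_mul_div, le_div_iff₀ ha0, one_mul]
      linarith [Real.add_one_le_exp (a * t)]
    calc t * Real.exp (-(s.re * t)) ≤ (1 / a * Real.exp (a * t)) * Real.exp (-(2 * a * t)) := by
          gcongr
      _ = 1 / a * Real.exp (-(a * t)) := by
          rw [mul_assoc, ← Real.exp_add]; ring_nf
  · refine Filter.Eventually.of_forall fun t s _ => ?_
    have h1 : HasDerivAt (fun s : ℂ => -s * t) (-(t : ℂ)) s := by
      simpa using (hasDerivAt_id s).neg.mul_const (t : ℂ)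
    have := (h1.cexp.mul_const (φ t))
    rwa [mul_comm (Complex.exp _)] at this

open FourierTransform in
theorem fourier_indicator_exp_mul (φ : ℝ → ℂ) (x y : ℝ) :
    𝓕 ((Set.Ioi (0 : ℝ)).indicator fun t => Complex.exp (-(x : ℂ) * t) * φ t) y =
      laplace φ (x + 2 * Real.pi * y * Complex.I) := by
  rw [Real.fourier_real_eq_integral_exp_smul, laplace, ← integral_indicator measurableSet_Ioi]
  congr with t
  by_cases ht : t ∈ Set.Ioi (0 : ℝ)
  · simp only [Set.indicator_of_mem ht, smul_eq_mul, ← mul_assoc, ← Complex.exp_add]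
    congr 2
    push_cast
    ring
  · simp [ht]

-- Every test function is the Fourier transform of a Schwartz function, so duality moves the
-- transform onto `u`, where it vanishes.
open FourierTransform SchwartzMap in
theorem ae_eq_zero_of_fourier_eq_zero {u : ℝ → ℂ} (hu : Integrable u) (h : ∀ y, 𝓕 u y = 0) :
    ∀ᵐ x, u x = 0 := by
  apply ae_eq_zero_of_integral_contDiff_smul_eq_zero hu.locallyIntegrable
  intro g hg hgc
  have hg₁ : HasCompactSupport (Complex.ofRealCLM ∘ g) := hgc.comp_left rfl
  have hg₂ : ContDiff ℝ ((⊤ : ℕ∞) : WithTop ℕ∞) (Complex.ofRealCLM ∘ g) :=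
    Complex.ofRealCLM.contDiff.comp hg
  set G : 𝓢(ℝ, ℂ) := hg₁.toSchwartzMap hg₂ with hG
  have e1 := integral_fourier_smul_schwartz hu (𝓕⁻ G)
  rw [← SchwartzMap.fourier_coe, FourierTransform.fourier_fourierInv_eq] at e1
  simp only [h, smul_zero, integral_zero] at e1
  rw [e1]
  simp [hG]

/-- The single line `Re s = 1` suffices: there the Laplace transform of the difference is the
Fourier transform of an integrable function. -/
theorem ae_eq_of_laplace_eq {p p' : ℝ} (hpp : p.HolderConjugate p') {φ ψ : ℝ → ℂ}
    (hφ : MemLp φ (ENNReal.ofReal p') (volume.restrict (Set.Ioi (0 : ℝ))))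
    (hψ : MemLp ψ (ENNReal.ofReal p') (volume.restrict (Set.Ioi (0 : ℝ))))
    (h : ∀ s ∈ rightHalfPlane, laplace φ s = laplace ψ s) :
    φ =ᵐ[volume.restrict (Set.Ioi (0 : ℝ))] ψ := by
  have hint := integrable_exp_neg_mul_mul hpp (hφ.sub hψ) (s := ((1 : ℝ) : ℂ)) (by simp)
  have key := ae_eq_zero_of_fourier_eq_zero (hint.integrable_indicator measurableSet_Ioi) fun y => by
    have hs : 0 < (((1 : ℝ) : ℂ) + 2 * Real.pi * y * Complex.I).re := by simp
    rw [fourier_indicator_exp_mul, laplace_sub hpp hφ hψ hs, h _ hs, sub_self]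
  rw [Filter.EventuallyEq, ae_restrict_iff' measurableSet_Ioi]
  filter_upwards [key] with t ht htm
  rw [Set.indicator_of_mem htm] at ht
  simpa [sub_eq_zero, Complex.exp_ne_zero] using ht

/-! ### Laplace representation of functions integrable on vertical lines -/

theorem lintegral_comp_two_pi_mul {f : ℝ → ℝ≥0∞} (hf : Measurable f) :
    ∫⁻ y, f (2 * Real.pi * y) = ENNReal.ofReal (1 / (2 * Real.pi)) * ∫⁻ y, f y := by
  have h2 : (2 * Real.pi) ≠ 0 := by positivity
  have h := Real.map_volume_mul_left h2
  rw [← lintegral_map (f := f) (μ := volume) hf (measurable_const_mul (2 * Real.pi)), h,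
    lintegral_smul_measure, abs_of_pos (by positivity)]
  simp

theorem isOpen_rightHalfPlane : IsOpen rightHalfPlane :=
  isOpen_lt continuous_const Complex.continuous_re

theorem continuous_comp_line {G : ℂ → ℂ} (hG : DifferentiableOn ℂ G rightHalfPlane) {x : ℝ}
    (hx : 0 < x) : Continuous fun y : ℝ => G (x + y * Complex.I) := by
  refine hG.continuousOn.comp_continuous (by fun_prop) fun y => ?_
  simpa [rightHalfPlane] using hx

theorem integrable_line {G : ℂ → ℂ} (hG : DifferentiableOn ℂ G rightHalfPlane) {x : ℝ}
    (hx : 0 < x) (hB : ∫⁻ y : ℝ, ‖G (x + y * Complex.I)‖ₑ ≠ ∞) :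
    Integrable fun y : ℝ => G (x + y * Complex.I) :=
  ⟨(continuous_comp_line hG hx).aestronglyMeasurable, hB.lt_top⟩

open Filter Topology in
/-- Shifting the contour of integration between vertical lines. -/
theorem integral_line_eq_of_lintegral_le {H : ℂ → ℂ} (hH : DifferentiableOn ℂ H rightHalfPlane)
    (hHm : Measurable H) {a b : ℝ} (ha : 0 < a) (hab : a ≤ b) {B : ℝ≥0}
    (hB : ∀ x ∈ Set.Icc a b, ∫⁻ y : ℝ, ‖H (x + y * Complex.I)‖ₑ ≤ B) :
    ∫ y : ℝ, H (a + y * Complex.I) = ∫ y : ℝ, H (b + y * Complex.I) := by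
  have hb : 0 < b := ha.trans_le hab
  have hia := integrable_line hH ha ((hB a ⟨le_rfl, hab⟩).trans_lt ENNReal.coe_lt_top).ne
  have hib := integrable_line hH hb ((hB b ⟨hab, le_rfl⟩).trans_lt ENNReal.coe_lt_top).ne
  set D : ℝ → ℂ := fun Y => (∫ y in (-Y)..Y, H (b + y * Complex.I)) -
    ∫ y in (-Y)..Y, H (a + y * Complex.I) with hD
  have hlim : Tendsto D atTop (𝓝 ((∫ y : ℝ, H (b + y * Complex.I)) -
      ∫ y : ℝ, H (a + y * Complex.I))) :=
    (intervalIntegral_tendsto_integral hib tendsto_neg_atTop_atBot tendsto_id).sub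
      (intervalIntegral_tendsto_integral hia tendsto_neg_atTop_atBot tendsto_id)
  have hprim : ∀ u : ℝ → ℂ, Integrable u → Continuous fun Y : ℝ => ∫ y in (-Y)..Y, u y := by
    intro u hu
    have hc := intervalIntegral.continuous_primitive (fun a b => hu.intervalIntegrable) 0 (μ := volume)
    have : (fun Y : ℝ => ∫ y in (-Y)..Y, u y) =
        fun Y => (∫ y in (0 : ℝ)..Y, u y) - ∫ y in (0 : ℝ)..(-Y), u y := by
      funext Y
      rw [intervalIntegral.integral_interval_sub_left] <;> exact hu.intervalIntegrable
    rw [this]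
    exact hc.sub (hc.comp continuous_neg)
  have hDc : Continuous D := (hprim _ hib).sub (hprim _ hia)
  -- `V` controls the horizontal sides of the rectangle. No pointwise decay of `H` is known, but `V`
  -- is integrable in `Y` by Tonelli, hence so is `D`.
  set V : ℝ → ℝ≥0∞ := fun Y => ∫⁻ x in Set.Ioc a b, ‖H (x + Y * Complex.I)‖ₑ with hV
  have hVm : Measurable V := by
    exact Measurable.lintegral_prod_right'
      (f := fun q : ℝ × ℝ => ‖H (q.2 + q.1 * Complex.I)‖ₑ) (by fun_prop)
  have hVi : ∫⁻ Y, V Y ≠ ∞ := by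
    have h1 : ∫⁻ Y, V Y = ∫⁻ x in Set.Ioc a b, ∫⁻ Y : ℝ, ‖H (x + Y * Complex.I)‖ₑ := by
      rw [hV, lintegral_lintegral_swap]
      exact Measurable.aemeasurable (by fun_prop)
    rw [h1]
    refine ((setLIntegral_mono' measurableSet_Ioc (g := fun _ => (B : ℝ≥0∞))
      fun x hx => hB x ⟨hx.1.le, hx.2⟩).trans_lt ?_).ne
    rw [setLIntegral_const]
    exact ENNReal.mul_lt_top ENNReal.coe_lt_top (by simp)
  have hle : ∀ Y, ‖D Y‖ₑ ≤ V (-Y) + V Y := by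
    intro Y
    have hrect := Complex.integral_boundary_rect_eq_zero_of_differentiableOn H
      (a + (-Y : ℝ) * Complex.I) (b + Y * Complex.I) (hH.mono ?_)
    · have e : D Y = Complex.I * ((∫ x in a..b, H (x + (-Y : ℝ) * Complex.I)) -
          ∫ x in a..b, H (x + Y * Complex.I)) := by
        simp only [Complex.add_re, Complex.add_im, Complex.ofReal_re, Complex.ofReal_im,
          Complex.mul_re, Complex.mul_im, Complex.I_re, Complex.I_im, mul_zero, mul_one, add_zero,
          zero_add, smul_eq_mul, sub_self] at hrect
        rw [hD]
        linear_combination (-Complex.I) * hrect + (((∫ y in (-Y)..Y, H (b + y * Complex.I)) -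
          ∫ y in (-Y)..Y, H (a + y * Complex.I))) * Complex.I_sq
      rw [e, enorm_mul]
      have hI : ‖Complex.I‖ₑ = 1 := by rw [← ofReal_norm]; simp
      rw [hI, one_mul, intervalIntegral.integral_of_le hab, intervalIntegral.integral_of_le hab]
      exact (enorm_sub_le).trans (add_le_add (enorm_integral_le_lintegral_enorm _)
        (enorm_integral_le_lintegral_enorm _))
    · intro z hz
      have hz := hz.1
      simp only [Complex.add_re, Complex.ofReal_re, Complex.mul_re, Complex.I_re, mul_zero,
        Complex.ofReal_im, Complex.I_im, mul_one, sub_self, add_zero, Set.uIcc_of_le hab] at hz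
      exact ha.trans_le hz.1
  have hDi : Integrable D := by
    refine ⟨hDc.aestronglyMeasurable, ?_⟩
    refine (lintegral_mono hle).trans_lt ?_
    have hneg : ∫⁻ Y, V (-Y) = ∫⁻ Y, V Y := lintegral_neg_eq_self V
    rw [lintegral_add_right _ hVm, hneg]
    exact ENNReal.add_lt_top.2 ⟨hVi.lt_top, hVi.lt_top⟩
  -- An integrable function that has a limit at infinity has limit zero.
  have hz := IntegrableAtFilter.eq_zero_of_tendsto (hDi.integrableAtFilter atTop) (fun s hs => by
    obtain ⟨c, hc⟩ := mem_atTop_sets.1 hs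
    exact measure_mono_top (s₁ := Set.Ici c) (fun x hx => hc x hx) Real.volume_Ici) hlim
  exact (sub_eq_zero.1 hz).symm

-- The factor `e^(-xt)` is split off so that the remaining integral has the analytic integrand
-- `e^(ts) G(s)`, to which contour shifting applies.
open FourierTransform in
theorem fourierInv_line_eq (G : ℂ → ℂ) (x t : ℝ) :
    𝓕⁻ (fun y : ℝ => G (x + ((2 * Real.pi * y : ℝ) : ℂ) * Complex.I)) t =
      (1 / (2 * Real.pi) : ℝ) • (Complex.exp (-(x * t : ℝ)) *
        ∫ y : ℝ, Complex.exp (t * (x + y * Complex.I)) * G (x + y * Complex.I)) := by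
  rw [Real.fourierInv_eq', ← integral_const_mul]
  have := Measure.integral_comp_mul_left (fun y : ℝ => Complex.exp (-(x * t : ℝ)) *
    (Complex.exp (t * (x + y * Complex.I)) * G (x + y * Complex.I))) (2 * Real.pi)
  rw [abs_of_pos (by positivity)] at this
  rw [one_div, ← this]
  congr with y
  rw [← mul_assoc, ← Complex.exp_add, smul_eq_mul]
  congr 2
  simp
  ring

-- The Bromwich integral is the same on every line, so one function `φ` serves all `x > 0`, with `‖φ
-- t‖ ≤ e^(xt) B` for each of them. This bound gives both the support and the integrability needed
-- for Fourier inversion on each line.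
open FourierTransform Filter Topology in
theorem exists_laplace_eq_of_lintegral_line_le {G : ℂ → ℂ}
    (hG : DifferentiableOn ℂ G rightHalfPlane) (hGm : Measurable G) {B : ℝ≥0}
    (hB : ∀ x : ℝ, 0 < x → ∫⁻ y : ℝ, ‖G (x + y * Complex.I)‖ₑ ≤ B) :
    ∃ φ : ℝ → ℂ, Continuous φ ∧ (∀ x : ℝ, 0 < x → ∀ t : ℝ, Complex.exp (-(x : ℂ) * t) * φ t =
        𝓕⁻ (fun y : ℝ => G (x + ((2 * Real.pi * y : ℝ) : ℂ) * Complex.I)) t) ∧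
      (∀ t < 0, φ t = 0) ∧ ∀ s ∈ rightHalfPlane, laplace φ s = G s := by
  set ℓ : ℝ → ℝ → ℂ := fun x y => G (x + ((2 * Real.pi * y : ℝ) : ℂ) * Complex.I) with hℓ
  have hline : ∀ x : ℝ, 0 < x → Integrable fun y : ℝ => G (x + y * Complex.I) := fun x hx =>
    integrable_line hG hx ((hB x hx).trans_lt ENNReal.coe_lt_top).ne
  have hℓi : ∀ x : ℝ, 0 < x → Integrable (ℓ x) := fun x hx =>
    (hline x hx).comp_mul_left' (by positivity)
  have hℓc : ∀ x : ℝ, 0 < x → Continuous (ℓ x) := fun x hx =>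
    (continuous_comp_line hG hx).comp (continuous_const_mul (2 * Real.pi))
  have hbound : ∀ x : ℝ, 0 < x → ∀ t, ‖𝓕⁻ (ℓ x) t‖ ≤ B := by
    intro x hx t
    rw [Real.fourierInv_eq_fourier_neg]
    have h1 : ∫⁻ y, ‖ℓ x y‖ₑ ≤ B := by
      rw [hℓ]
      have := lintegral_comp_two_pi_mul (f := fun y : ℝ => ‖G (x + y * Complex.I)‖ₑ)
        (by fun_prop)
      rw [this]
      refine (mul_le_mul_right (hB x hx) _).trans ?_
      refine mul_le_of_le_one_left' ?_
      rw [ENNReal.ofReal_le_one, div_le_one (by positivity)]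
      linarith [Real.pi_gt_three]
    have h2 := (enorm_fourier_le_lintegral (ℓ x) (-t)).trans h1
    rwa [← ofReal_norm, ← ENNReal.ofReal_coe_nnreal,
      ENNReal.ofReal_le_ofReal_iff B.coe_nonneg] at h2
  set W : ℝ → ℝ → ℂ := fun x t =>
    ∫ y : ℝ, Complex.exp (t * (x + y * Complex.I)) * G (x + y * Complex.I)
  have hWle : ∀ a b : ℝ, 0 < a → a ≤ b → ∀ t, W a t = W b t := by
    intro a b ha hab t
    set M : ℝ≥0 := (Real.exp (|t| * b)).toNNReal
    refine integral_line_eq_of_lintegral_le (H := fun s => Complex.exp (t * s) * G s)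
      (B := M * B) ?_ ?_ ha hab ?_
    · exact DifferentiableOn.mul (by fun_prop) hG
    · fun_prop
    · intro x hx
      have hx0 : 0 < x := ha.trans_le hx.1
      calc ∫⁻ y : ℝ, ‖Complex.exp (t * (x + y * Complex.I)) * G (x + y * Complex.I)‖ₑ
          ≤ ∫⁻ y : ℝ, (M : ℝ≥0∞) * ‖G (x + y * Complex.I)‖ₑ := by
            apply lintegral_mono
            intro y
            beta_reduce
            rw [enorm_mul]
            gcongr
            rw [← ofReal_norm, Complex.norm_exp]
            refine ENNReal.ofReal_le_ofReal (Real.exp_le_exp.2 ?_)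
            have : ((t : ℂ) * (x + y * Complex.I)).re = t * x := by simp
            rw [this]
            nlinarith [le_abs_self t, abs_nonneg t, hx.2]
        _ ≤ _ := by
            rw [lintegral_const_mul' _ _ ENNReal.coe_ne_top, ENNReal.coe_mul]
            gcongr
            exact hB x hx0
  have hWeq : ∀ x : ℝ, 0 < x → ∀ t, W x t = W 1 t := by
    intro x hx t
    rcases le_total x 1 with h | h
    · exact hWle x 1 hx h t
    · exact (hWle 1 x one_pos h t).symm
  set φ : ℝ → ℂ := fun t => Complex.exp t * 𝓕⁻ (ℓ 1) t with hφ
  have hφx : ∀ x : ℝ, 0 < x → ∀ t : ℝ, Complex.exp (-(x : ℂ) * t) * φ t = 𝓕⁻ (ℓ x) t := by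
    intro x hx t
    have h1 := fourierInv_line_eq G x t
    have h2 := fourierInv_line_eq G 1 t
    change 𝓕⁻ (ℓ x) t = (1 / (2 * Real.pi) : ℝ) • (Complex.exp (-(x * t : ℝ)) * W x t) at h1
    change 𝓕⁻ (ℓ 1) t = (1 / (2 * Real.pi) : ℝ) • (Complex.exp (-(1 * t : ℝ)) * W 1 t) at h2
    rw [hφ, h1, hWeq x hx]
    simp only [h2]
    rw [Complex.real_smul, Complex.real_smul]
    have : Complex.exp t * Complex.exp (-(1 * t : ℝ)) = 1 := by
      rw [← Complex.exp_add]; simp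
    have e : Complex.exp (-(x * t : ℝ)) = Complex.exp (-(x : ℂ) * t) := by
      push_cast; ring_nf
    rw [e]
    linear_combination (Complex.exp (-(x : ℂ) * t) * ((1 / (2 * Real.pi) : ℝ) : ℂ) * W 1 t) * this
  have hφb : ∀ x : ℝ, 0 < x → ∀ t : ℝ, ‖φ t‖ ≤ Real.exp (x * t) * B := by
    intro x hx t
    have h1 := hbound x hx t
    rw [← hφx x hx t, norm_mul, Complex.norm_exp] at h1
    have e : (-(x : ℂ) * t).re = -(x * t) := by simp
    rw [e] at h1
    calc ‖φ t‖ = Real.exp (x * t) * (Real.exp (-(x * t)) * ‖φ t‖) := by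
          rw [← mul_assoc, ← Real.exp_add]; simp
      _ ≤ _ := by gcongr
  -- For negative `t` the bound `e^(xt) B` tends to zero as the line moves to the right.
  have hφneg : ∀ t < 0, φ t = 0 := by
    intro t ht
    have hlim : Tendsto (fun x : ℝ => Real.exp (x * t) * B) atTop (𝓝 (0 * B)) := by
      refine Tendsto.mul_const _ (Real.tendsto_exp_atBot.comp ?_)
      exact tendsto_id.atTop_mul_const_of_neg ht
    rw [zero_mul] at hlim
    have : ‖φ t‖ ≤ 0 := ge_of_tendsto hlim
      ((eventually_gt_atTop 0).mono fun x hx => hφb x hx t)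
    simpa using this
  refine ⟨φ, ?_, hφx, hφneg, ?_⟩
  · have := continuous_fourierInv (hℓi 1 one_pos)
    fun_prop
  · intro s hs
    have hs : 0 < s.re := hs
    set x := s.re with hx
    set y := s.im / (2 * Real.pi) with hy
    have hsy : s = x + 2 * Real.pi * y * Complex.I := by
      apply Complex.ext
      · simp [hx]
      · have : ((2 : ℂ) * Real.pi * y * Complex.I).im = 2 * Real.pi * y := by
          rw [show (2 : ℂ) * Real.pi * y = ((2 * Real.pi * y : ℝ) : ℂ) by push_cast; rfl]
          simp
        rw [Complex.add_im, this, Complex.ofReal_im, hy]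
        field_simp
        simp
    have hae : (Set.Ioi (0 : ℝ)).indicator (fun t : ℝ => Complex.exp (-(x : ℂ) * t) * φ t)
        =ᵐ[volume] 𝓕⁻ (ℓ x) := by
      filter_upwards [Measure.ae_ne volume (0 : ℝ)] with t ht
      rcases lt_or_gt_of_ne ht with h | h
      · rw [Set.indicator_of_notMem (by simpa using h.le), ← hφx x hs t, hφneg t h, mul_zero]
      · rw [Set.indicator_of_mem (Set.mem_Ioi.2 h), hφx x hs t]
    have hint : Integrable (𝓕⁻ (ℓ x)) := by
      refine Integrable.congr ?_ hae
      rw [integrable_indicator_iff measurableSet_Ioi]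
      -- Applying the growth bound on the line `x/2` leaves a decay of `e^(-xt/2)`.
      have hexp := (integrableOn_exp_mul_Ioi (show -(x / 2) < 0 by linarith) 0).mul_const (B : ℝ)
      refine hexp.mono' ?_ ?_
      · refine Continuous.aestronglyMeasurable ?_
        rw [show (fun t : ℝ => Complex.exp (-(x : ℂ) * t) * φ t) = 𝓕⁻ (ℓ x) from
          funext (hφx x hs)]
        exact continuous_fourierInv (hℓi x hs)
      · refine Filter.Eventually.of_forall fun t => ?_
        rw [norm_mul, Complex.norm_exp]
        have e : (-(x : ℂ) * t).re = -(x * t) := by simp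
        rw [e]
        calc Real.exp (-(x * t)) * ‖φ t‖ ≤ Real.exp (-(x * t)) * (Real.exp (x / 2 * t) * B) := by
              gcongr
              exact hφb _ (by linarith) t
          _ = Real.exp (-(x / 2) * t) * B := by
              rw [← mul_assoc, ← Real.exp_add]; ring_nf
    have hint' : Integrable (𝓕 (ℓ x)) := by
      have := hint.comp_neg
      refine this.congr (Filter.Eventually.of_forall fun t => ?_)
      simp [Real.fourierInv_eq_fourier_neg]
    have key := fourier_indicator_exp_mul φ x y
    rw [Real.fourier_congr_ae hae, (hℓc x hs).fourier_fourierInv_eq (hℓi x hs) hint', ← hsy] at key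
    rw [← key, hsy, hℓ]
    push_cast
    rfl

/-! ### Hardy functions as Laplace transforms -/

theorem eLpNorm_line_eq_hardyMean {p : ℝ} (hp : 0 < p) {F : ℂ → ℂ} (hF : Measurable F) (x : ℝ) :
    eLpNorm (fun y : ℝ => F (x + ((2 * Real.pi * y : ℝ) : ℂ) * Complex.I)) (ENNReal.ofReal p)
      volume = hardyMean p F x := by
  rw [eLpNorm_eq_lintegral_rpow_enorm_toReal (by simpa using hp) (by simp),
    ENNReal.toReal_ofReal hp.le, hardyMean,
    lintegral_comp_two_pi_mul (f := fun y : ℝ => ‖F (x + y * Complex.I)‖ₑ ^ p) (by fun_prop)]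

/-- The functions `k / (k + s)`, which are bounded by `1` on the right half-plane and tend to `1`
as `k` tends to infinity. -/
noncomputable def cutoff (k : ℕ) (s : ℂ) : ℂ := ((k + 1 : ℕ) : ℂ) / (((k + 1 : ℕ) : ℂ) + s)

theorem measurable_cutoff (k : ℕ) : Measurable (cutoff k) := by
  unfold cutoff; fun_prop

theorem natCast_add_one_add_ne_zero (k : ℕ) {s : ℂ} (hs : 0 < s.re) :
    ((k + 1 : ℕ) : ℂ) + s ≠ 0 := by
  intro h
  have := congrArg Complex.re h
  rw [Complex.add_re, Complex.natCast_re, Complex.zero_re] at this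
  have : (0 : ℝ) < (k + 1 : ℕ) := by positivity
  linarith

theorem differentiableOn_cutoff (k : ℕ) : DifferentiableOn ℂ (cutoff k) rightHalfPlane :=
  DifferentiableOn.div (by fun_prop) (by fun_prop) fun _ hs => natCast_add_one_add_ne_zero k hs

theorem norm_cutoff_sq_le (k : ℕ) {x : ℝ} (hx : 0 < x) (y : ℝ) :
    ‖cutoff k (x + y * Complex.I)‖ ^ 2 ≤ (1 + (y / (k + 1 : ℕ)) ^ 2)⁻¹ := by
  have hk : (0 : ℝ) < (k + 1 : ℕ) := by positivity
  rw [cutoff, norm_div, div_pow, Complex.norm_natCast, ← Complex.normSq_eq_norm_sq,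
    show (((k + 1 : ℕ) : ℂ) + (x + y * Complex.I)) = (((k + 1 : ℕ) + x : ℝ) : ℂ) + y * Complex.I by
      push_cast; ring, Complex.normSq_add_mul_I, ← one_div, div_le_div_iff₀ (by positivity)
      (by positivity)]
  have : ((k + 1 : ℕ) : ℝ) ^ 2 * (1 + (y / (k + 1 : ℕ)) ^ 2) = ((k + 1 : ℕ) : ℝ) ^ 2 + y ^ 2 := by
    field_simp
  rw [this]
  nlinarith

theorem norm_cutoff_le_one (k : ℕ) {x : ℝ} (hx : 0 < x) (y : ℝ) :
    ‖cutoff k (x + y * Complex.I)‖ ≤ 1 := by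
  have h := norm_cutoff_sq_le k hx y
  have h2 : (1 + (y / (k + 1 : ℕ)) ^ 2)⁻¹ ≤ 1 :=
    inv_le_one_of_one_le₀ (by nlinarith [sq_nonneg (y / (k + 1 : ℕ))])
  exact (sq_le_one_iff₀ (norm_nonneg _)).1 (h.trans h2)

open Filter Topology in
theorem tendsto_cutoff (s : ℂ) : Tendsto (fun k => cutoff k s) atTop (𝓝 1) :=
  (tendsto_add_atTop_iff_nat (f := fun n : ℕ => (n : ℂ) / (n + s)) 1).2
    (tendsto_natCast_div_add_atTop s)

/-- The modulus is at most `1`, so for `q ≥ 2` its `q`-th power is below its square, which is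
dominated by a Cauchy density independent of `x`. With Hölder, this makes the cut-off Hardy function
uniformly integrable in `L¹` norm over all lines. -/
theorem exists_lintegral_cutoff_rpow_le (k : ℕ) {q : ℝ} (hq : 2 ≤ q) :
    ∃ Q : ℝ≥0, ∀ x : ℝ, 0 < x → ∫⁻ y : ℝ, ‖cutoff k (x + y * Complex.I)‖ₑ ^ q ≤ Q := by
  have hk : ((k + 1 : ℕ) : ℝ) ≠ 0 := by positivity
  have hi : Integrable fun y : ℝ => (1 + (y / (k + 1 : ℕ)) ^ 2)⁻¹ :=
    integrable_inv_one_add_sq.comp_div hk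
  have hfin : ∫⁻ y : ℝ, ENNReal.ofReal (1 + (y / (k + 1 : ℕ)) ^ 2)⁻¹ ≠ ∞ :=
    hi.lintegral_lt_top.ne
  refine ⟨(∫⁻ y : ℝ, ENNReal.ofReal (1 + (y / (k + 1 : ℕ)) ^ 2)⁻¹).toNNReal, fun x hx => ?_⟩
  rw [ENNReal.coe_toNNReal hfin]
  apply lintegral_mono
  intro y
  beta_reduce
  rw [← ofReal_norm, ENNReal.ofReal_rpow_of_nonneg (norm_nonneg _) (by linarith)]
  apply ENNReal.ofReal_le_ofReal
  refine le_trans ?_ (norm_cutoff_sq_le k hx y)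
  rw [← Real.rpow_two]
  exact Real.rpow_le_rpow_of_exponent_ge' (norm_nonneg _) (norm_cutoff_le_one k hx y)
    (by norm_num) hq

theorem exists_lintegral_mul_cutoff_le {p p' : ℝ} (hpp : p.HolderConjugate p') (hp' : 2 ≤ p')
    {F : ℂ → ℂ} (hFm : Measurable F) {C : ℝ≥0} (hC : ∀ x : ℝ, 0 < x → hardyMean p F x ≤ C)
    (k : ℕ) : ∃ B : ℝ≥0, ∀ x : ℝ, 0 < x →
      ∫⁻ y : ℝ, ‖F (x + y * Complex.I) * cutoff k (x + y * Complex.I)‖ₑ ≤ B := by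
  have hp0 : 0 < p := hpp.pos
  have hp'0 : 0 < p' := hpp.symm.pos
  have h2pi : 0 < 2 * Real.pi := by positivity
  obtain ⟨Q, hQ⟩ := exists_lintegral_cutoff_rpow_le k hp'
  have hcm := measurable_cutoff k
  refine ⟨((2 * Real.pi).toNNReal * C ^ p) ^ (1 / p) * Q ^ (1 / p'), fun x hx => ?_⟩
  have hA : ∫⁻ y : ℝ, ‖F (x + y * Complex.I)‖ₑ ^ p ≤
      (((2 * Real.pi).toNNReal * C ^ p : ℝ≥0) : ℝ≥0∞) := by
    have h := hC x hx
    rw [hardyMean, one_div p, ENNReal.rpow_inv_le_iff hp0] at h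
    rw [ENNReal.coe_mul, ENNReal.coe_rpow_of_nonneg _ hp0.le]
    calc ∫⁻ y : ℝ, ‖F (x + y * Complex.I)‖ₑ ^ p = ENNReal.ofReal (2 * Real.pi) *
          (ENNReal.ofReal (1 / (2 * Real.pi)) * ∫⁻ y : ℝ, ‖F (x + y * Complex.I)‖ₑ ^ p) := by
          rw [← mul_assoc, ← ENNReal.ofReal_mul h2pi.le, mul_one_div_cancel h2pi.ne']
          simp
      _ ≤ _ := mul_le_mul_right h _
  simp only [enorm_mul]
  refine (ENNReal.lintegral_mul_le_Lp_mul_Lq volume hpp (f := fun y : ℝ => ‖F (x + y * Complex.I)‖ₑ)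
    (g := fun y : ℝ => ‖cutoff k (x + y * Complex.I)‖ₑ) (by fun_prop) (by fun_prop)).trans ?_
  rw [ENNReal.coe_mul, ENNReal.coe_rpow_of_nonneg _ (by positivity),
    ENNReal.coe_rpow_of_nonneg _ (by positivity)]
  gcongr
  exact hQ x hx

open Filter Topology in
theorem tendsto_eLpNorm_mul_cutoff_sub {p : ℝ} (hp : 0 < p) {u : ℝ → ℂ}
    (hu : MemLp u (ENNReal.ofReal p)) (hum : Measurable u) {x : ℝ} (hx : 0 < x) {v : ℝ → ℝ}
    (hv : Measurable v) :
    Tendsto (fun k => eLpNorm ((fun y => u y * cutoff k (x + v y * Complex.I)) - u)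
      (ENNReal.ofReal p) volume) atTop (𝓝 0) := by
  have hp1 : ENNReal.ofReal p ≠ 0 := by simpa using hp
  simp_rw [eLpNorm_eq_lintegral_rpow_enorm_toReal hp1 ENNReal.ofReal_ne_top,
    ENNReal.toReal_ofReal hp.le]
  have hcm := measurable_cutoff
  have hfin := (eLpNorm_lt_top_iff_lintegral_rpow_enorm_lt_top hp1 ENNReal.ofReal_ne_top).1 hu.2
  rw [ENNReal.toReal_ofReal hp.le] at hfin
  have key : Tendsto (fun k => ∫⁻ y, ‖((fun y => u y * cutoff k (x + v y * Complex.I)) - u) y‖ₑ ^ p)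
      atTop (𝓝 (∫⁻ _ : ℝ, 0)) := by
    refine tendsto_lintegral_of_dominated_convergence
      (fun y => ENNReal.ofReal (2 ^ p) * ‖u y‖ₑ ^ p) ?_ ?_ ?_ ?_
    · intro k
      have := hcm k
      simp only [Pi.sub_apply]
      fun_prop
    · intro k
      refine Eventually.of_forall fun y => ?_
      beta_reduce
      rw [← ENNReal.ofReal_rpow_of_nonneg (by norm_num) hp.le,
        ← ENNReal.mul_rpow_of_nonneg _ _ hp.le]
      refine ENNReal.rpow_le_rpow ?_ hp.le
      rw [← ofReal_norm, ← ofReal_norm, ← ENNReal.ofReal_mul (by norm_num)]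
      apply ENNReal.ofReal_le_ofReal
      calc ‖u y * cutoff k (x + v y * Complex.I) - u y‖ ≤ ‖u y * cutoff k (x + v y * Complex.I)‖ +
            ‖u y‖ := norm_sub_le _ _
        _ ≤ ‖u y‖ * 1 + ‖u y‖ := by
            rw [norm_mul]; gcongr; exact norm_cutoff_le_one k hx _
        _ = 2 * ‖u y‖ := by ring
    · rw [lintegral_const_mul' _ _ ENNReal.ofReal_ne_top]
      exact (ENNReal.mul_lt_top ENNReal.ofReal_lt_top hfin).ne
    · refine Eventually.of_forall fun y => ?_
      have h1 : Tendsto (fun k => u y * cutoff k (x + v y * Complex.I) - u y) atTop (𝓝 0) := by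
        simpa using ((tendsto_cutoff (x + v y * Complex.I)).const_mul (u y)).sub_const (u y)
      have h2 := (ENNReal.continuous_rpow_const (y := p)).tendsto _ |>.comp h1.enorm
      simpa [Function.comp_def, ENNReal.zero_rpow_of_pos hp] using h2
  have h3 := ((ENNReal.continuous_rpow_const (y := 1 / p)).tendsto _).comp key
  simpa [Function.comp_def, ENNReal.zero_rpow_of_pos (inv_pos.2 hp)] using h3

-- On the line `Re s = 1` the cut-off functions converge in `L^p`, so `e^(-t) φ k` converges in
-- `L^{p'}` to some `u`, and `e^t u` is the candidate. Its transform is first identified for `Re s >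
-- 1`, then everywhere by the identity theorem.
open FourierTransform Filter Topology in
theorem exists_memLp_laplace_eq_of_measurable {p p' : ℝ} (hp1 : 1 < p) (hp2 : p ≤ 2)
    (hpp : p.HolderConjugate p') {F : ℂ → ℂ} (hF : MemHardy p F) (hFm : Measurable F) :
    ∃ φ : ℝ → ℂ, MemLp φ (ENNReal.ofReal p') (volume.restrict (Set.Ioi (0 : ℝ))) ∧
      ∀ s ∈ rightHalfPlane, laplace φ s = F s := by
  obtain ⟨hFd, C, hC⟩ := hF
  have hp0 : 0 < p := hpp.pos
  have hp'2 : 2 ≤ p' := by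
    nlinarith [sub_one_mul_sub_one_of_holderConjugate hpp, hpp.symm.lt]
  have hcm := measurable_cutoff
  choose B hB using exists_lintegral_mul_cutoff_le hpp hp'2 hFm hC
  have hGd : ∀ k, DifferentiableOn ℂ (fun s => F s * cutoff k s) rightHalfPlane := fun k =>
    hFd.mul (differentiableOn_cutoff k)
  have hGm : ∀ k, Measurable (fun s => F s * cutoff k s) := fun k => hFm.mul (hcm k)
  choose φ hφc hφx hφneg hφL using fun k =>
    exists_laplace_eq_of_lintegral_line_le (hGd k) (hGm k) (hB k)
  set ℓ : ℕ → ℝ → ℝ → ℂ := fun k x y => F (x + ((2 * Real.pi * y : ℝ) : ℂ) * Complex.I) *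
    cutoff k (x + ((2 * Real.pi * y : ℝ) : ℂ) * Complex.I) with hℓ
  have hℓi : ∀ k, ∀ x : ℝ, 0 < x → Integrable (ℓ k x) := fun k x hx =>
    (integrable_line (hGd k) hx ((hB k x hx).trans_lt ENNReal.coe_lt_top).ne).comp_mul_left'
      (R := 2 * Real.pi) (by positivity)
  have hℓle : ∀ k, ∀ x : ℝ, 0 < x → eLpNorm (ℓ k x) (ENNReal.ofReal p) volume ≤ C := by
    intro k x hx
    refine le_trans ?_ (hC x hx)
    rw [← eLpNorm_line_eq_hardyMean hp0 hFm]
    apply eLpNorm_mono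
    intro y
    rw [hℓ, norm_mul]
    exact mul_le_of_le_one_right (norm_nonneg _) (norm_cutoff_le_one k hx _)
  obtain ⟨K, hK⟩ := exists_eLpNorm_fourierInv_le hp1 hp2 hpp
  -- Hausdorff–Young bounds `e^(-xt) φ k` uniformly in `x`. Fatou along `x = 1/(m+1) → 0` removes
  -- the weight.
  have hφle : ∀ k, eLpNorm (φ k) (ENNReal.ofReal p') volume ≤ K * C := by
    intro k
    refine Lp.eLpNorm_le_of_ae_tendsto (u := atTop)
      (f := fun (m : ℕ) (t : ℝ) => Complex.exp (-((1 / ((m : ℝ) + 1) : ℝ) : ℂ) * t) * φ k t) ?_ ?_ ?_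
    · refine Eventually.of_forall fun m => ?_
      have hm : (0 : ℝ) < 1 / ((m : ℝ) + 1) := by positivity
      rw [funext (hφx k _ hm)]
      exact (hK _ (hℓi k _ hm)).trans (mul_le_mul_right (hℓle k _ hm) _)
    · intro m
      have := hφc k
      exact Continuous.aestronglyMeasurable (by fun_prop)
    · refine Eventually.of_forall fun t => ?_
      have hc : Continuous fun x : ℝ => Complex.exp (-(x : ℂ) * t) * φ k t := by fun_prop
      have := (hc.tendsto 0).comp (tendsto_one_div_add_atTop_nhds_zero_nat (𝕜 := ℝ))
      simpa [Function.comp_def] using this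
  have hHm : Measurable fun y : ℝ => F ((1 : ℝ) + ((2 * Real.pi * y : ℝ) : ℂ) * Complex.I) := by
    fun_prop
  have hH : MemLp (fun y : ℝ => F ((1 : ℝ) + ((2 * Real.pi * y : ℝ) : ℂ) * Complex.I))
      (ENNReal.ofReal p) := by
    refine ⟨hHm.aestronglyMeasurable, ?_⟩
    rw [eLpNorm_line_eq_hardyMean hp0 hFm]
    exact (hC 1 one_pos).trans_lt ENNReal.coe_lt_top
  obtain ⟨u, hu, hulim⟩ := exists_tendsto_eLpNorm_fourierInv hp1 hp2 hpp
    (fun k => hℓi k 1 one_pos)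
    (fun k => ⟨(hℓi k 1 one_pos).1, (hℓle k 1 one_pos).trans_lt ENNReal.coe_lt_top⟩) hH
    (tendsto_eLpNorm_mul_cutoff_sub hp0 hH hHm one_pos (v := fun y => 2 * Real.pi * y)
      (by fun_prop))
  have hp'0 : ENNReal.ofReal p' ≠ 0 := by simpa using hpp.symm.pos
  have hmeas := tendstoInMeasure_of_tendsto_eLpNorm hp'0
    (fun k => (continuous_fourierInv (hℓi k 1 one_pos)).aestronglyMeasurable) hu.1 hulim
  obtain ⟨ns, -, hns⟩ := hmeas.exists_seq_tendsto_ae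
  set ψ : ℝ → ℂ := fun t => Complex.exp t * u t with hψ
  have hexp : Continuous fun t : ℝ => Complex.exp t := by fun_prop
  have hφe : ∀ k t, φ k t = Complex.exp t * 𝓕⁻ (ℓ k 1) t := by
    intro k t
    have := hφx k 1 one_pos t
    change _ = 𝓕⁻ (ℓ k 1) t at this
    rw [← this, ← mul_assoc, ← Complex.exp_add]
    simp
  -- Membership of `u` alone controls only `e^(-t) ψ`. Fatou along the a.e. convergent subsequence
  -- carries the uniform bound on `φ k` over to `ψ`.
  have hψL : MemLp ψ (ENNReal.ofReal p') := by
    refine ⟨hexp.aestronglyMeasurable.mul hu.1, ?_⟩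
    refine lt_of_le_of_lt (Lp.eLpNorm_le_of_ae_tendsto (u := atTop) (f := fun i => φ (ns i))
      (C := K * C) (Eventually.of_forall fun i => hφle _)
      (fun i => (hφc _).aestronglyMeasurable) ?_)
      (ENNReal.mul_lt_top ENNReal.coe_lt_top ENNReal.coe_lt_top)
    filter_upwards [hns] with t ht
    simp only [hφe]
    exact ht.const_mul _
  have hshift : ∀ (v : ℝ → ℂ) (s : ℂ), laplace (fun t => Complex.exp t * v t) s =
      laplace v (s - 1) := by
    intro v s
    simp only [laplace]
    congr with t
    rw [← mul_assoc, ← Complex.exp_add]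
    ring_nf
  have hφm : ∀ k, MemLp (𝓕⁻ (ℓ k 1)) (ENNReal.ofReal p') := fun k =>
    ⟨(continuous_fourierInv (hℓi k 1 one_pos)).aestronglyMeasurable,
      ((hK _ (hℓi k 1 one_pos)).trans (mul_le_mul_right (hℓle k 1 one_pos) _)).trans_lt
        (ENNReal.mul_lt_top ENNReal.coe_lt_top ENNReal.coe_lt_top)⟩
  -- Convergence is known only with the weight `e^(-t)`, which shifts `s` to `s - 1`. Hölder then
  -- needs `Re s > 1`.
  have hright : ∀ s : ℂ, 1 < s.re → laplace ψ s = F s := by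
    intro s hs
    have hs1 : 0 < (s - 1).re := by simpa using hs
    have hlim1 : Tendsto (fun k => laplace (φ k) s) atTop (𝓝 (F s)) := by
      simp_rw [fun k => hφL k s (show 0 < s.re by linarith)]
      simpa using (tendsto_cutoff s).const_mul (F s)
    have hlim2 : Tendsto (fun k => laplace (φ k) s) atTop (𝓝 (laplace ψ s)) := by
      rw [tendsto_iff_edist_tendsto_0]
      have hle : ∀ k, edist (laplace (φ k) s) (laplace ψ s) ≤
          eLpNorm (fun t : ℝ => Complex.exp (-(s - 1) * t)) (ENNReal.ofReal p)
            (volume.restrict (Set.Ioi (0 : ℝ))) *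
          eLpNorm (𝓕⁻ (ℓ k 1) - u) (ENNReal.ofReal p') volume := by
        intro k
        rw [edist_eq_enorm_sub, funext (hφe k), hψ, hshift, hshift,
          ← laplace_sub hpp ((hφm k).restrict _) (hu.restrict _) hs1]
        refine (enorm_laplace_le hpp ((hφm k).1.sub hu.1).restrict _).trans ?_
        exact mul_le_mul_right (eLpNorm_mono_measure _ Measure.restrict_le_self) _
      refine tendsto_of_tendsto_of_tendsto_of_le_of_le tendsto_const_nhds ?_
        (fun _ => zero_le) hle
      simpa using ENNReal.Tendsto.const_mul hulim
        (Or.inr (memLp_exp_neg_mul hs1 hp0).2.ne)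
    exact tendsto_nhds_unique hlim2 hlim1
  refine ⟨ψ, hψL.restrict _, ?_⟩
  have hpre : IsPreconnected rightHalfPlane := (convex_halfSpace_re_gt 0).isPreconnected
  refine ((differentiableOn_laplace hpp (hψL.restrict _)).analyticOnNhd
    isOpen_rightHalfPlane).eqOn_of_preconnected_of_eventuallyEq
    (hFd.analyticOnNhd isOpen_rightHalfPlane) hpre (z₀ := 2) (by simp [rightHalfPlane]) ?_
  filter_upwards [(isOpen_lt continuous_const Complex.continuous_re).mem_nhds
    (show (1 : ℝ) < (2 : ℂ).re by norm_num)] with s hs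
  exact hright s hs

theorem MemHardy.congr {q : ℝ} {Φ Ψ : ℂ → ℂ} (hΦ : MemHardy q Φ)
    (h : ∀ s ∈ rightHalfPlane, Ψ s = Φ s) : MemHardy q Ψ := by
  refine ⟨hΦ.1.congr h, hΦ.2.imp fun C hC x hx => ?_⟩
  refine le_of_eq_of_le ?_ (hC x hx)
  simp only [hardyMean]
  congr 3
  funext y
  rw [h _ (show 0 < ((x : ℂ) + y * Complex.I).re by simpa using hx)]

/-- Every function in the Hardy space `H^p` of the right half-plane, `1 < p ≤ 2`, is the Laplace
transform of a function in `L^{p'}`. -/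
theorem MemHardy.exists_memLp_laplace_eq {p p' : ℝ} (hp1 : 1 < p) (hp2 : p ≤ 2)
    (hpp : p.HolderConjugate p') {F : ℂ → ℂ} (hF : MemHardy p F) :
    ∃ φ : ℝ → ℂ, MemLp φ (ENNReal.ofReal p') (volume.restrict (Set.Ioi (0 : ℝ))) ∧
      ∀ s ∈ rightHalfPlane, laplace φ s = F s := by
  classical
  -- Nothing is known about `F` off the half-plane; replacing it there by zero gives global
  -- measurability.
  have heq : Set.EqOn (rightHalfPlane.indicator F) F rightHalfPlane :=
    fun s hs => Set.indicator_of_mem hs F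
  have hm : Measurable (rightHalfPlane.indicator F) := by
    rw [← Set.piecewise_eq_indicator]
    exact hF.1.continuousOn.measurable_piecewise continuousOn_const
      isOpen_rightHalfPlane.measurableSet
  obtain ⟨φ, hφ, h⟩ := exists_memLp_laplace_eq_of_measurable hp1 hp2 hpp (hF.congr heq) hm
  exact ⟨φ, hφ, fun s hs => (h s hs).trans (heq hs)⟩

/-! ### Liouville's theorem and the solution of the equation -/

open Filter Topology in
/-- Functions continuous on the half-plane that agree off the zeros of `f` agree everywhere. -/
theorem eqOn_rightHalfPlane_of_eq_off_zeros {D : Set ℂ} (hDo : IsOpen D) (hDc : IsConnected D)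
    (hD : rightHalfPlane ⊆ D) {f : ℂ → ℂ} (hf : DifferentiableOn ℂ f D) (hf0 : ∃ s ∈ D, f s ≠ 0)
    {u v : ℂ → ℂ} (hu : ContinuousOn u rightHalfPlane) (hv : ContinuousOn v rightHalfPlane)
    (h : ∀ s ∈ rightHalfPlane, f s ≠ 0 → u s = v s) : ∀ s ∈ rightHalfPlane, u s = v s := by
  intro s hs
  obtain ⟨z, hz, hfz⟩ := hf0
  have hne : ∀ᶠ w in 𝓝[≠] s, f w ≠ 0 := by
    by_contra hfreq
    refine hfz ((hf.analyticOnNhd hDo).eqOn_zero_of_preconnected_of_frequently_eq_zero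
      hDc.isPreconnected (hD hs) hfreq hz)
  have hnhds := isOpen_rightHalfPlane.mem_nhds hs
  have hev : u =ᶠ[𝓝[≠] s] v := by
    filter_upwards [hne, mem_nhdsWithin_of_mem_nhds hnhds] with w hw hws
    exact h w hws hw
  exact tendsto_nhds_unique (((hu.continuousAt hnhds).mono_left nhdsWithin_le_nhds).congr' hev)
    ((hv.continuousAt hnhds).mono_left nhdsWithin_le_nhds)

open Filter Topology in
theorem eq_zero_of_norm_le_div_rpow {g : ℂ → ℂ} (hg : Differentiable ℂ g) {C q : ℝ} (hq : 0 < q)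
    (h : ∀ᶠ s in Bornology.cobounded ℂ, ‖g s‖ ≤ C / ‖s‖ ^ q) (s : ℂ) : g s = 0 := by
  refine hg.apply_eq_of_tendsto_cocompact s ?_
  rw [← Metric.cobounded_eq_cocompact]
  exact squeeze_zero_norm' h
    (((tendsto_rpow_atTop hq).comp tendsto_norm_cobounded_atTop).const_div_atTop C)

theorem memLp_coe {q : ℝ} (φ : LpHalfLine q) :
    MemLp φ (ENNReal.ofReal q) (volume.restrict (Set.Ioi (0 : ℝ))) :=
  Lp.memLp φ

theorem isInverseLaplace_of_laplace_eq {p p' : ℝ} (hpp : p.HolderConjugate p') {Φ : ℂ → ℂ}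
    {φ : LpHalfLine p'} (h : ∀ s ∈ rightHalfPlane, laplace φ s = Φ s) :
    IsInverseLaplace p' Φ φ :=
  ⟨h, fun ψ hψ => Lp.ext (ae_eq_of_laplace_eq hpp (memLp_coe ψ) (memLp_coe φ) fun s hs =>
    (hψ s hs).trans (h s hs).symm)⟩

theorem mainTheorem7
    (p p' : ℝ) (hp1 : 1 < p) (hp2 : p ≤ 2) (hpp' : 1 / p + 1 / p' = 1)
    -- the symbol `f`, analytic on a region `D` containing the half-plane, not identically zero
    (D : Set ℂ) (hDo : IsOpen D) (hDc : IsConnected D) (hD : rightHalfPlane ⊆ D)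
    (f : ℂ → ℂ) (hf : DifferentiableOn ℂ f D) (hf0 : ∃ s ∈ D, f s ≠ 0)
    -- the fixed analytic function `r`
    (E : Set ℂ) (hEo : IsOpen E) (hEc : IsConnected E) (hE : rightHalfPlane ⊆ E)
    (r : ℂ → ℂ) (hr : DifferentiableOn ℂ r E)
    -- the source `J`
    (J : LpHalfLine p') (hJ : MemHardy p (laplace J))
    -- `Φ = (ℒ(J) + r) / f` and `Ψ = ℒ(J) / f` are in the Hardy space
    (Φ : ℂ → ℂ) (hΦ : IsQuotient (fun s => laplace J s + r s) f Φ) (hΦp : MemHardy p Φ)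
    (Ψ : ℂ → ℂ) (hΨ : IsQuotient (laplace J) f Ψ) (hΨp : MemHardy p Ψ)
    -- `g = r / f` is entire and satisfies the decay bound
    (g : ℂ → ℂ) (hg : IsQuotient r f g) (hg_entire : Differentiable ℂ g)
    (C q : ℝ) (hq : 0 < q)
    (hgrowth : ∀ᶠ s in Bornology.cobounded ℂ, ‖g s‖ ≤ C / ‖s‖ ^ q) :
    ∃ φ : LpHalfLine p',
      (∀ ψ : LpHalfLine p', IsSolution p p' f r J ψ ↔ ψ = φ) ∧
        IsInverseLaplace p' Φ φ ∧ IsInverseLaplace p' Ψ φ := by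
  have hpp : p.HolderConjugate p' :=
    Real.holderConjugate_iff.2 ⟨hp1, by simpa only [one_div] using hpp'⟩
  have hfc : ContinuousOn f rightHalfPlane := hf.continuousOn.mono hD
  have hLc : ∀ ψ : LpHalfLine p', ContinuousOn (laplace ψ) rightHalfPlane := fun ψ =>
    (differentiableOn_laplace hpp (memLp_coe ψ)).continuousOn
  have hext {u v : ℂ → ℂ} (hu : ContinuousOn u rightHalfPlane) (hv : ContinuousOn v rightHalfPlane)
      (h : ∀ s ∈ rightHalfPlane, f s ≠ 0 → u s = v s) : ∀ s ∈ rightHalfPlane, u s = v s :=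
    eqOn_rightHalfPlane_of_eq_off_zeros hDo hDc hD hf hf0 hu hv h
  -- Since `g` vanishes by Liouville, `r` vanishes wherever `f` does not, and `hext` covers the
  -- zeros of `f`.
  have hr0 : ∀ s ∈ rightHalfPlane, r s = 0 := by
    refine hext (hr.continuousOn.mono hE) continuousOn_const fun s hs hfs => ?_
    have := hg s hs hfs
    rw [eq_zero_of_norm_le_div_rpow hg_entire hq hgrowth s, eq_comm, div_eq_zero_iff] at this
    exact this.resolve_right hfs
  have hΦΨ : ∀ s ∈ rightHalfPlane, Ψ s = Φ s := by
    refine hext hΨp.1.continuousOn hΦp.1.continuousOn fun s hs hfs => ?_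
    rw [hΨ s hs hfs, hΦ s hs hfs]
    simp [hr0 s hs]
  obtain ⟨φ₀, hφ₀, hφL⟩ := hΨp.exists_memLp_laplace_eq hp1 hp2 hpp
  set φ : LpHalfLine p' := hφ₀.toLp φ₀
  have hφΨ : ∀ s ∈ rightHalfPlane, laplace φ s = Ψ s := fun s hs =>
    (laplace_congr_ae hφ₀.coeFn_toLp s).trans (hφL s hs)
  have hinv : IsInverseLaplace p' Ψ φ := isInverseLaplace_of_laplace_eq hpp hφΨ
  refine ⟨φ, fun ψ => ⟨fun hψ => hinv.2 ψ ?_, ?_⟩,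
    isInverseLaplace_of_laplace_eq hpp fun s hs => (hφΨ s hs).trans (hΦΨ s hs), hinv⟩
  -- Any solution has `f ℒ(ψ) = ℒ(J)`, so its transform must be `Ψ`, which determines it.
  · refine hext (hLc ψ) hΨp.1.continuousOn fun s hs hfs => ?_
    have h := hψ.2.1 s hs
    rw [symbolHat, hr0 s hs, sub_zero] at h
    rw [hΨ s hs hfs, h, mul_div_cancel_left₀ _ hfs]
  · rintro rfl
    have hsym : ∀ s ∈ rightHalfPlane, symbolHat f r φ s = laplace J s := by
      intro s hs
      rw [symbolHat, hr0 s hs, sub_zero]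
      refine hext (u := fun s => f s * laplace φ s) (hfc.mul (hLc φ)) (hLc J)
        (fun s hs hfs => ?_) s hs
      rw [hφΨ s hs, hΨ s hs hfs, mul_div_cancel₀ _ hfs]
    exact ⟨hJ.congr hsym, isInverseLaplace_of_laplace_eq hpp fun s hs => (hsym s hs).symm⟩
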